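/- Let $V\ge 0$ be a trace class operator on a complex Hilbert space, let $L_0=0$ and $L_1={\rm i}V$, and let $\{\alpha_n\}$ be the family of eigenvalues of $V$ counted with multiplicities (every nonzero eigenvalue occurs as often as its multiplicity; the value $0$ may occur any number of times, and $0\cdot|\log 0|=0$). Let $\mathscr S\{L_1,L_0\}$ be the set of spectral shift functions of the pair $\{L_1,L_0\}$, i.e. of the functions $\omega:\mathbb R\to\mathbb C$ in $L^1(\mathbb R,(1+t^2)^{-1}dt)$ such that $$\operatorname{trace}\big((L_1-\tau I)^{-1}-(L_0-\tau I)^{-1}\big)=-\int_{\mathbb R}\frac{\omega(t)}{(t-\tau)^2}\,dt\qquad\text{for all }\tau\in\mathbb C\text{ with }\operatorname{Im}\tau<0.$$ Then: (i) the set $\mathscr S\{L_1,L_0\}$ contains a purely imaginary function (a function with zero real part); (ii) the set $\mathscr S\{L_1,L_0\}$ contains a real-valued function if and only if $\sum_n\alpha_n|\log\alpha_n|<\infty$. -/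

import Mathlib

open MeasureTheory

/-- A bounded operator `T` on a Hilbert space is of trace class if `∑ᵢ (|T| eᵢ, eᵢ) < ∞` for an
orthonormal basis `(eᵢ)`, where `|T| = (T* T)^{1/2}`.  (The terms are nonnegative and the sum does
not depend on the basis.) -/
def IsTraceClass {H : Type*} [NormedAddCommGroup H] [InnerProductSpace ℂ H] [CompleteSpace H]
    (T : H →L[ℂ] H) : Prop :=
  ∃ (s : Set H) (b : HilbertBasis s ℂ H),
    Summable fun i : s => (inner ℂ (b i) (CFC.abs T (b i))).re

/-- `T` is of trace class and its trace `∑ᵢ (T eᵢ, eᵢ)` is `a`, in every orthonormal basis. -/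
def HasTrace {H : Type*} [NormedAddCommGroup H] [InnerProductSpace ℂ H] [CompleteSpace H]
    (T : H →L[ℂ] H) (a : ℂ) : Prop :=
  IsTraceClass T ∧
    ∀ (s : Set H) (b : HilbertBasis s ℂ H), HasSum (fun i : s => inner ℂ (b i) (T (b i))) a

/-- The set of spectral shift functions of a pair `{L₁, L₀}` of bounded operators: the
functions `ω ∈ L¹(ℝ, (1 + t²)⁻¹ dt)` such that
`trace ((L₁ - τ I)⁻¹ - (L₀ - τ I)⁻¹) = - ∫ ω(t) / (t - τ)² dt` for all `τ` in the open lower half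
plane.  That these `τ` are regular points of both operators (so that the inverses are genuine) and
that the difference of the resolvents is of trace class is part of the condition. -/
def spectralShiftFunctions {H : Type*} [NormedAddCommGroup H] [InnerProductSpace ℂ H]
    [CompleteSpace H] (L₁ L₀ : H →L[ℂ] H) : Set (ℝ → ℂ) :=
  {ω | Integrable (fun t : ℝ => ω t / (1 + (t : ℂ) ^ 2)) ∧
    ∀ τ : ℂ, τ.im < 0 →
      τ ∈ resolventSet ℂ L₁ ∧ τ ∈ resolventSet ℂ L₀ ∧
      HasTrace (Ring.inverse (L₁ - τ • (1 : H →L[ℂ] H)) - Ring.inverse (L₀ - τ • (1 : H →L[ℂ] H)))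
        (-∫ t : ℝ, ω t / ((t : ℂ) - τ) ^ 2)}

/-- The real family `α` lists the eigenvalues of the self-adjoint operator `V` counted with
multiplicities: every real `μ ≠ 0` occurs exactly `dim ker (V - μ I)` times
(zero times if `μ` is not an eigenvalue).  How often `0` occurs is left free, so that the
family may be a sequence padded with zeros. -/
def IsEigenvalueFamily {H : Type*} [NormedAddCommGroup H] [InnerProductSpace ℂ H]
    (V : H →L[ℂ] H) {ι : Type*} (α : ι → ℝ) : Prop :=
  ∀ μ : ℝ, μ ≠ 0 → {n | α n = μ}.encard =
    Cardinal.toENat (Module.rank ℂ (Module.End.eigenspace (V : H →ₗ[ℂ] H) (μ : ℂ)))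

/-!
In an orthonormal eigenbasis of `V`, with eigenvalues `aᵢ ≥ 0`, `∑ aᵢ < ∞`, the trace of the
resolvent difference at `τ` is `∑ᵢ ((i aᵢ - τ)⁻¹ + τ⁻¹)`, so that membership in the set of spectral
shift functions becomes the scalar identity of `mem_spectralShiftFunctions_iff`. Each term of that
sum is `-∫₀^{aᵢ} i (i s - τ)⁻² ds`, and for `s > 0` and `τ` in the lower half plane both `i` times
the Poisson kernel `s / (t² + s²)` and the conjugate Poisson kernel `t / (t² + s²)` integrate
against `(t - τ)⁻²` to `π i (i s - τ)⁻²` (`integral_poisson_div_sq`, `integral_conjPoisson_div_sq`).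
Integrating these kernels in `s` over the intervals `(0, aᵢ]` gives two candidates:

* `(i / 2π) ∑ log (1 + aᵢ² / t²)`, purely imaginary; the Poisson kernel has integral `π`, so this
  is always integrable against `(1 + t²)⁻¹` (`exists_imaginary_shift`);
* `π⁻¹ ∑ arctan (aᵢ / t)`, real; the conjugate kernel has integral `O(1 + s + |log s|)` against
  `(1 + t²)⁻¹`, and `∑ ∫₀^{aᵢ} |log s| ds` is finite if `∑ aᵢ |log aᵢ|` is (`exists_real_shift`).

Conversely, let `ω` be a real spectral shift function. Taking imaginary parts in the trace formula
at `τ = -i y` gives `∑ aᵢ / (aᵢ + y) = ∫ ω(t) 2 t y² / (t² + y²)² dt`. Integrate over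
`0 < y ≤ 1`: the left side becomes `∑ aᵢ log (1 + 1 / aᵢ)`, while the kernel on the right is
`O((1 + t²)⁻¹)` after integration in `y` (`summable_mul_abs_log_of_real_shift`). This needs no
description of all real spectral shift functions.
-/

/-! ### Operators diagonal in an orthonormal basis -/

section Operators

variable {H : Type*} [NormedAddCommGroup H] [InnerProductSpace ℂ H] {ι κ : Type*}

/-- Parseval's identity. -/
lemma HilbertBasis.hasSum_norm_inner_sq (b : HilbertBasis ι ℂ H) (x : H) :
    HasSum (fun i => ‖(inner ℂ (b i) x : ℂ)‖ ^ 2) (‖x‖ ^ 2) := by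
  have h := b.hasSum_inner_mul_inner x x
  rw [inner_self_eq_norm_sq_to_K] at h
  have h2 : HasSum (fun i => ((‖(inner ℂ (b i) x : ℂ)‖ ^ 2 : ℝ) : ℂ)) ((‖x‖ ^ 2 : ℝ) : ℂ) := by
    rw [Complex.ofReal_pow]
    refine h.congr_fun fun i => ?_
    rw [← inner_conj_symm x (b i), mul_comm, Complex.mul_conj, Complex.normSq_eq_norm_sq]
  exact_mod_cast h2

/-- For nonnegative weights `w`, the numbers `∑ᵢ wᵢ |⟨bᵢ, c⟩|²` sum over an orthonormal basis
`(c)` to `∑ᵢ wᵢ`: absolute summability of the double series. -/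
lemma HilbertBasis.summable_weight_mul_norm_inner_sq (b : HilbertBasis ι ℂ H)
    (c : HilbertBasis κ ℂ H) {w : ι → ℝ} (hw : ∀ i, 0 ≤ w i) (hs : Summable w) :
    Summable fun p : ι × κ => w p.1 * ‖(inner ℂ (b p.1) (c p.2) : ℂ)‖ ^ 2 := by
  have key : ∀ i, HasSum (fun j => w i * ‖(inner ℂ (b i) (c j) : ℂ)‖ ^ 2) (w i) := by
    intro i
    have := (c.hasSum_norm_inner_sq (b i)).mul_left (w i)
    simpa [b.orthonormal.1 i, norm_inner_symm (b i)] using this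
  refine (summable_prod_of_nonneg fun p => mul_nonneg (hw _) (by positivity)).2
    ⟨fun i => (key i).summable, ?_⟩
  simpa [(key _).tsum_eq] using hs

/-- The quadratic form of an operator which is diagonal in an orthonormal basis. -/
lemma HilbertBasis.hasSum_inner_apply_of_diagonal (b : HilbertBasis ι ℂ H) {T : H →L[ℂ] H}
    {l : ι → ℂ} (hT : ∀ i, T (b i) = l i • b i) (x : H) :
    HasSum (fun i => l i * ((‖(inner ℂ (b i) x : ℂ)‖ ^ 2 : ℝ) : ℂ)) (inner ℂ x (T x)) := by
  have h := ((b.hasSum_repr x).mapL T).mapL (innerSL ℂ x)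
  simp only [innerSL_apply_apply] at h
  refine h.congr_fun fun i => ?_
  rw [map_smul, hT, b.repr_apply_apply, inner_smul_right, inner_smul_right,
    ← inner_conj_symm x (b i)]
  have := Complex.mul_conj (inner ℂ (b i) x)
  rw [Complex.normSq_eq_norm_sq] at this
  rw [← this]; ring

/-- An operator diagonal in one orthonormal basis with absolutely summable eigenvalues has a
convergent diagonal sum, of the same value, in every orthonormal basis. -/
lemma HilbertBasis.hasSum_inner_apply_of_summable (b : HilbertBasis ι ℂ H)
    (c : HilbertBasis κ ℂ H) {T : H →L[ℂ] H} {l : ι → ℂ} (hT : ∀ i, T (b i) = l i • b i)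
    (hl : Summable fun i => ‖l i‖) :
    HasSum (fun j => (inner ℂ (c j) (T (c j)) : ℂ)) (∑' i, l i) := by
  have hs : Summable fun p : ι × κ => l p.1 * ((‖(inner ℂ (b p.1) (c p.2) : ℂ)‖ ^ 2 : ℝ) : ℂ) := by
    refine Summable.of_norm ?_
    simpa using b.summable_weight_mul_norm_inner_sq c (fun i => norm_nonneg (l i)) hl
  have h1 : ∀ i, HasSum (fun j => l i * ((‖(inner ℂ (b i) (c j) : ℂ)‖ ^ 2 : ℝ) : ℂ)) (l i) := by
    intro i
    have := c.hasSum_norm_inner_sq (b i)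
    rw [b.orthonormal.1 i] at this
    have := (Complex.hasSum_ofReal.2 this).mul_left (l i)
    simpa [norm_inner_symm (b i)] using this
  have h2 := hs.hasSum.prod_fiberwise h1
  rw [h2.tsum_eq]
  have h3 := hs.hasSum
  rw [← (Equiv.prodComm κ ι).hasSum_iff] at h3
  exact h3.prod_fiberwise fun j => b.hasSum_inner_apply_of_diagonal hT (c j)

/-- Uniqueness of the nonnegative square root on a single vector: for `r > 0` this holds because
`A + r` is injective, for `r = 0` because `‖A x‖² = ⟨x, A² x⟩`. -/
lemma apply_eq_smul_of_nonneg_of_apply_apply {A : H →L[ℂ] H} (hA : 0 ≤ A) {r : ℝ} (hr : 0 ≤ r)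
    {x : H} (hx : A (A x) = ((r : ℂ) ^ 2) • x) : A x = (r : ℂ) • x := by
  have hpos := (ContinuousLinearMap.nonneg_iff_isPositive A).1 hA
  rcases hr.eq_or_lt with rfl | hr
  · have h1 : (inner ℂ (A x) (A x) : ℂ) = inner ℂ x (A (A x)) := hpos.isSymmetric x (A x)
    rw [hx] at h1
    simpa using h1
  · rw [← sub_eq_zero]
    set w := A x - (r : ℂ) • x with hw
    have hAw : A w = -((r : ℂ) • w) := by
      rw [hw, map_sub, map_smul, hx, smul_sub, smul_smul]
      ring_nf; abel
    have h0 : 0 ≤ (inner ℂ w (A w) : ℂ).re := hpos.re_inner_nonneg_right w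
    rw [hAw, inner_neg_right, inner_smul_right, inner_self_eq_norm_sq_to_K] at h0
    have h3 : r * ‖w‖ ^ 2 ≤ 0 := by
      have : (-((r : ℂ) * ((‖w‖ : ℝ) : ℂ) ^ 2)) = ((-(r * ‖w‖ ^ 2) : ℝ) : ℂ) := by push_cast; ring
      erw [this, Complex.ofReal_re] at h0
      linarith
    have h4 : ‖w‖ ^ 2 ≤ 0 := by
      by_contra hc
      push Not at hc
      nlinarith [mul_pos hr hc]
    exact norm_eq_zero.1 (by nlinarith [norm_nonneg w])

variable [CompleteSpace H]

lemma HilbertBasis.abs_apply_of_diagonal (b : HilbertBasis ι ℂ H) {T : H →L[ℂ] H} {l : ι → ℂ}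
    (hT : ∀ i, T (b i) = l i • b i) (i : ι) :
    CFC.abs T (b i) = ((‖l i‖ : ℝ) : ℂ) • b i := by
  have hstar : star T (b i) = (starRingEnd ℂ (l i)) • b i := by
    apply b.repr.injective
    ext j
    rw [b.repr_apply_apply, b.repr_apply_apply, ContinuousLinearMap.star_eq_adjoint,
      ContinuousLinearMap.adjoint_inner_right, hT, inner_smul_left, inner_smul_right]
    by_cases h : j = i
    · rw [h]
    · simp [b.orthonormal.2 h]
  refine apply_eq_smul_of_nonneg_of_apply_apply (CFC.abs_nonneg T) (norm_nonneg _) ?_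
  have h := congrArg (fun S : H →L[ℂ] H => S (b i)) (CFC.abs_mul_abs T)
  simp only [mul_apply_eq_comp] at h
  rw [h, hT, map_smul, hstar, smul_smul, Complex.mul_conj, Complex.normSq_eq_norm_sq]
  push_cast; rfl

/-- An operator diagonal in an orthonormal basis with absolutely summable eigenvalues is of trace
class, and its trace is the sum of the eigenvalues. -/
lemma hasTrace_of_diagonal (b : HilbertBasis ι ℂ H) {T : H →L[ℂ] H} {l : ι → ℂ}
    (hT : ∀ i, T (b i) = l i • b i) (hl : Summable fun i => ‖l i‖) :
    HasTrace T (∑' i, l i) := by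
  refine ⟨?_, fun s c => b.hasSum_inner_apply_of_summable c hT hl⟩
  obtain ⟨s, c, -⟩ := exists_hilbertBasis ℂ H
  have := b.hasSum_inner_apply_of_summable c (b.abs_apply_of_diagonal hT) (by simpa using hl)
  exact ⟨s, c, (Complex.hasSum_re this).summable⟩

lemma HasTrace.unique {T : H →L[ℂ] H} {x y : ℂ} (hx : HasTrace T x) (hy : HasTrace T y) :
    x = y := by
  obtain ⟨s, c, -⟩ := exists_hilbertBasis ℂ H
  exact (hx.2 s c).unique (hy.2 s c)

/-- A Hilbert–Schmidt operator is compact: it is the norm limit of its finite sections. -/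
lemma isCompactOperator_of_summable_norm_sq (c : HilbertBasis ι ℂ H) {T : H →L[ℂ] H}
    (h : Summable fun i => ‖T (c i)‖ ^ 2) : IsCompactOperator T := by
  classical
  set F : Finset ι → H →L[ℂ] H := fun s =>
    ∑ i ∈ s, (innerSL ℂ (c i)).smulRight (T (c i)) with hF
  refine isCompactOperator_of_tendsto (l := Filter.atTop) (F := F) ?_ (.of_forall fun s => ?_)
  · rw [Metric.tendsto_atTop]
    intro ε hε
    obtain ⟨s, hs⟩ := summable_iff_vanishing_norm.1 h ((ε / 2) ^ 2) (by positivity)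
    refine ⟨s, fun t hst => ?_⟩
    rw [dist_comm, dist_eq_norm]
    refine lt_of_le_of_lt (ContinuousLinearMap.opNorm_le_bound _ (half_pos hε).le fun x => ?_)
      (half_lt_self hε)
    have hsum : HasSum (fun i => (inner ℂ (c i) x : ℂ) • T (c i)) (T x) := by
      simpa [c.repr_apply_apply] using (c.hasSum_repr x).mapL T
    have hlim : Filter.Tendsto (fun u : Finset ι =>
        ‖∑ i ∈ u, (inner ℂ (c i) x : ℂ) • T (c i) - F t x‖) Filter.atTop
        (nhds ‖T x - F t x‖) := ((hsum.sub_const (F t x))).norm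
    refine le_of_tendsto hlim ?_
    filter_upwards [Filter.eventually_ge_atTop t] with u hu
    have hFt : F t x = ∑ i ∈ t, (inner ℂ (c i) x : ℂ) • T (c i) := by
      simp [hF]
    rw [hFt, ← Finset.sum_sdiff hu, add_sub_cancel_right]
    have h1 : ∑ i ∈ u \ t, ‖T (c i)‖ ^ 2 ≤ (ε / 2) ^ 2 :=
      (le_abs_self _).trans (hs (u \ t) (Finset.sdiff_disjoint.mono_right hst)).le
    have h2 : ∑ i ∈ u \ t, ‖(inner ℂ (c i) x : ℂ)‖ ^ 2 ≤ ‖x‖ ^ 2 :=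
      sum_le_hasSum _ (fun i _ => by positivity) (c.hasSum_norm_inner_sq x)
    calc ‖∑ i ∈ u \ t, (inner ℂ (c i) x : ℂ) • T (c i)‖
        ≤ ∑ i ∈ u \ t, ‖(inner ℂ (c i) x : ℂ)‖ * ‖T (c i)‖ :=
          (norm_sum_le _ _).trans (Finset.sum_le_sum fun i _ => (norm_smul _ _).le)
      _ ≤ √((∑ i ∈ u \ t, ‖(inner ℂ (c i) x : ℂ)‖ ^ 2) * ∑ i ∈ u \ t, ‖T (c i)‖ ^ 2) :=
          Real.le_sqrt_of_sq_le (Finset.sum_mul_sq_le_sq_mul_sq _ _ _)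
      _ ≤ √((ε / 2 * ‖x‖) ^ 2) := by
          apply Real.sqrt_le_sqrt
          rw [mul_pow, mul_comm]
          gcongr
      _ = ε / 2 * ‖x‖ := Real.sqrt_sq (by positivity)
  · refine Finset.sum_induction _ (fun S : H →L[ℂ] H => IsCompactOperator S)
      (fun a b ha hb => ha.add hb) isCompactOperator_zero fun i _ => ?_
    exact (isCompactOperator_of_locallyCompactSpace_rng (M₂ := ℂ)
      (T := (ContinuousLinearMap.toSpanSingleton ℂ (T (c i))))).comp_clm (innerSL ℂ (c i))

lemma IsTraceClass.isCompactOperator {V : H →L[ℂ] H} (hV : 0 ≤ V) (h : IsTraceClass V) :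
    IsCompactOperator V := by
  obtain ⟨s, c, hc⟩ := h
  rw [CFC.abs_of_nonneg V hV] at hc
  have hpos := (ContinuousLinearMap.nonneg_iff_isPositive V).1 hV
  -- with `V = A²`, `‖V c‖² ≤ ‖A‖² ‖A c‖² = ‖A‖² ⟨c, V c⟩`
  set A := CFC.sqrt V
  have hA : IsSelfAdjoint A := (CFC.sqrt_nonneg V).isSelfAdjoint
  have hAA : ∀ x, A (A x) = V x := fun x =>
    congrArg (fun S : H →L[ℂ] H => S x) (CFC.sqrt_mul_sqrt_self V hV)
  refine isCompactOperator_of_summable_norm_sq c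
    (Summable.of_nonneg_of_le (fun _ => by positivity) (fun i => ?_) (hc.mul_left (‖A‖ ^ 2)))
  have h1 : ((inner ℂ (c i) (V (c i)) : ℂ)).re = ‖A (c i)‖ ^ 2 := by
    rw [← hAA, ← ContinuousLinearMap.adjoint_inner_left, hA.adjoint_eq,
      inner_self_eq_norm_sq_to_K]
    norm_cast
  rw [h1, ← hAA, ← mul_pow]
  gcongr
  exact A.le_opNorm _

end Operators

/-! ### Eigenvalues and resolvents of a positive trace class operator -/

section Spectral

variable {H : Type*} [NormedAddCommGroup H] [InnerProductSpace ℂ H] [CompleteSpace H]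

/-- A positive trace class operator is diagonal in some orthonormal basis, with nonnegative
summable eigenvalues. -/
lemma exists_hilbertBasis_diagonal.{u} {H : Type u} [NormedAddCommGroup H] [InnerProductSpace ℂ H]
    [CompleteSpace H] {V : H →L[ℂ] H} (hV : 0 ≤ V) (hV1 : IsTraceClass V) :
    ∃ (κ : Type u) (b : HilbertBasis κ ℂ H) (a : κ → ℝ),
      (∀ i, V (b i) = (a i : ℂ) • b i) ∧ (∀ i, 0 ≤ a i) ∧ Summable a := by
  have hpos := (ContinuousLinearMap.nonneg_iff_isPositive V).1 hV
  have hsymm : (V : H →ₗ[ℂ] H).IsSymmetric := hpos.isSymmetric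
  have hbot := ContinuousLinearMap.orthogonalComplement_iSup_eigenspaces_eq_bot
    (hV1.isCompactOperator hV) hsymm
  have hE : ∀ μ : ℂ, ∃ (w : Set (Module.End.eigenspace (V : H →ₗ[ℂ] H) μ))
      (b : HilbertBasis w ℂ (Module.End.eigenspace (V : H →ₗ[ℂ] H) μ)), ⇑b = ((↑) : w → _) := by
    intro μ
    have : IsClosed ((Module.End.eigenspace (V : H →ₗ[ℂ] H) μ : Submodule ℂ H) : Set H) := by
      have h1 : ((Module.End.eigenspace (V : H →ₗ[ℂ] H) μ : Submodule ℂ H) : Set H) =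
          {x | V x = μ • x} := by
        ext x; simp
      rw [h1]
      exact isClosed_eq V.continuous (continuous_const_smul μ)
    have : CompleteSpace (Module.End.eigenspace (V : H →ₗ[ℂ] H) μ) := this.completeSpace_coe
    exact exists_hilbertBasis ℂ _
  choose w b hb using hE
  have hon := hsymm.orthogonalFamily_eigenspaces.orthonormal_sigma_orthonormal
    (v_family := fun μ => ⇑(b μ)) (fun μ => (b μ).orthonormal)
  set v : (Σ μ : ℂ, w μ) → H := fun p => (b p.1 p.2 : H) with hv
  have hon' : Orthonormal ℂ v := hon
  have hspan : (Submodule.span ℂ (Set.range v))ᗮ = ⊥ := by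
    rw [eq_bot_iff, ← hbot, ← Submodule.iInf_orthogonal]
    refine le_iInf_iff.2 fun μ x hx => (Submodule.mem_orthogonal' _ _).2 fun y hy => ?_
    have h1 := ((b μ).hasSum_repr ⟨y, hy⟩).mapL
      ((innerSL ℂ x).comp (Module.End.eigenspace (V : H →ₗ[ℂ] H) μ).subtypeL)
    refine (h1.congr_fun (g := fun _ => 0) fun i => ?_).unique hasSum_zero
    have h2 : inner ℂ x (v ⟨μ, i⟩) = 0 :=
      (Submodule.mem_orthogonal' _ _).1 hx _ (Submodule.subset_span ⟨_, rfl⟩)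
    rw [map_smul]
    exact (smul_eq_zero_of_right _ h2).symm
  let B := HilbertBasis.mkOfOrthogonalEqBot hon' hspan
  have hB : ⇑B = v := HilbertBasis.coe_mkOfOrthogonalEqBot hon' hspan
  have hVB : ∀ p, V (B p) = p.1 • B p := fun p => by
    rw [hB]
    exact Module.End.mem_eigenspace_iff.1 (b p.1 p.2).2
  have hval : ∀ p : (Σ μ : ℂ, w μ), inner ℂ (B p) (V (B p)) = p.1 := fun p => by
    rw [hVB, inner_smul_right, inner_self_eq_norm_sq_to_K, B.orthonormal.1 p]; simp
  have hre : ∀ p : (Σ μ : ℂ, w μ), ((p.1.re : ℝ) : ℂ) = p.1 := fun p => by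
    have h : inner ℂ (V (B p)) (B p) = inner ℂ (B p) (V (B p)) := hpos.isSymmetric (B p) (B p)
    rw [← inner_conj_symm, hval] at h
    exact Complex.conj_eq_iff_re.1 h
  have hnn : ∀ p : (Σ μ : ℂ, w μ), 0 ≤ p.1.re := fun p => by
    have h : 0 ≤ (inner ℂ (B p) (V (B p)) : ℂ).re := hpos.re_inner_nonneg_right _
    rwa [hval] at h
  have hVB' : ∀ p : (Σ μ : ℂ, w μ), V (B p) = ((p.1.re : ℝ) : ℂ) • B p := fun p => by rw [hre, hVB]
  refine ⟨_, B, fun p : (Σ μ : ℂ, w μ) => p.1.re, hVB', hnn, ?_⟩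
  obtain ⟨s, c, hc⟩ := hV1
  rw [CFC.abs_of_nonneg V hV] at hc
  -- `⟨c, V c⟩ = ∑ₚ aₚ |⟨Bₚ, c⟩|²`, and the sum over `c` may be taken first
  have h1 : ∀ j, HasSum (fun p : (Σ μ : ℂ, w μ) => p.1.re * ‖(inner ℂ (B p) (c j) : ℂ)‖ ^ 2)
      (inner ℂ (c j) (V (c j)) : ℂ).re := fun j => by
    refine (Complex.hasSum_re (B.hasSum_inner_apply_of_diagonal hVB' (c j))).congr_fun fun p => ?_
    rw [← Complex.ofReal_mul, Complex.ofReal_re]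
  have h2 : Summable fun q : s × (Σ μ : ℂ, w μ) =>
      q.2.1.re * ‖(inner ℂ (B q.2) (c q.1) : ℂ)‖ ^ 2 :=
    (summable_prod_of_nonneg fun q => mul_nonneg (hnn _) (by positivity)).2
      ⟨fun j => (h1 j).summable, by simpa only [(h1 _).tsum_eq] using hc⟩
  have h3 := ((summable_prod_of_nonneg fun q => mul_nonneg (hnn _) (by positivity)).1
    ((Equiv.prodComm _ _).summable_iff.2 h2)).2
  refine h3.congr fun (p : Σ μ : ℂ, w μ) => ?_
  have := (c.hasSum_norm_inner_sq (B p)).mul_left p.1.re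
  rw [B.orthonormal.1 p, one_pow, mul_one] at this
  rw [← this.tsum_eq]
  refine tsum_congr fun j => ?_
  simp [norm_inner_symm (B p)]

variable {κ : Type*} {V : H →L[ℂ] H} {b : HilbertBasis κ ℂ H} {a : κ → ℝ}

open scoped ComplexOrder in
lemma mem_resolventSet_I_smul (hV : 0 ≤ V) {τ : ℂ} (hτ : τ.im < 0) :
    τ ∈ resolventSet ℂ (Complex.I • V) := by
  have h1 : -Complex.I * τ ∉ spectrum ℂ V := by
    intro h
    have h2 := spectrum_nonneg_of_nonneg hV h
    rw [Complex.le_def] at h2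
    simp at h2
    linarith [h2.1]
  have h3 : IsUnit (algebraMap ℂ (H →L[ℂ] H) (-Complex.I * τ) - V) := by
    simpa [spectrum.mem_iff] using h1
  rw [spectrum.mem_resolventSet_iff]
  have h4 : algebraMap ℂ (H →L[ℂ] H) τ - Complex.I • V =
      (Units.mk0 Complex.I Complex.I_ne_zero) •
        (algebraMap ℂ (H →L[ℂ] H) (-Complex.I * τ) - V) := by
    rw [Units.smul_mk0, smul_sub, Algebra.algebraMap_eq_smul_one, Algebra.algebraMap_eq_smul_one,
      smul_smul]
    simp [← mul_assoc]
  rw [h4]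
  exact h3.smul _

omit [CompleteSpace H] in
lemma mem_resolventSet_zero {τ : ℂ} (hτ : τ ≠ 0) : τ ∈ resolventSet ℂ (0 : H →L[ℂ] H) := by
  rw [spectrum.mem_resolventSet_iff, sub_zero]
  exact hτ.isUnit.map _

omit [CompleteSpace H] in
lemma ringInverse_sub_smul_apply {L : H →L[ℂ] H} {τ l : ℂ} (hτ : τ ∈ resolventSet ℂ L) (hl : l ≠ τ)
    {x : H} (hx : L x = l • x) :
    Ring.inverse (L - τ • (1 : H →L[ℂ] H)) x = (l - τ)⁻¹ • x := by
  have hu : IsUnit (L - τ • (1 : H →L[ℂ] H)) := by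
    rw [spectrum.mem_resolventSet_iff, Algebra.algebraMap_eq_smul_one] at hτ
    simpa using hτ.neg
  have h := congrArg (fun S : H →L[ℂ] H => S x) (Ring.inverse_mul_cancel _ hu)
  have h2 : (L - τ • (1 : H →L[ℂ] H)) x = (l - τ) • x := by
    simp [hx, sub_smul]
  simp only [mul_apply_eq_comp, one_apply_eq_self, h2, map_smul] at h
  rw [eq_inv_smul_iff₀ (sub_ne_zero.2 hl)]
  exact h

/-- The value at `τ` of the trace of the difference of the resolvents of `i α` and `0`
on a one-dimensional space. -/
noncomputable def resolventTerm (τ : ℂ) (r : ℝ) : ℂ := (Complex.I * r - τ)⁻¹ + τ⁻¹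

lemma resolventTerm_eq {τ : ℂ} (hτ : τ.im < 0) {r : ℝ} (hr : 0 ≤ r) :
    resolventTerm τ r = Complex.I * r * ((Complex.I * r - τ)⁻¹ * τ⁻¹) := by
  have h1 : τ ≠ 0 := by rintro rfl; simp at hτ
  have h2 : Complex.I * r - τ ≠ 0 := fun h => by
    have := congrArg Complex.im h
    simp at this; linarith
  rw [resolventTerm]; field_simp; ring

lemma norm_resolventTerm_le {τ : ℂ} (hτ : τ.im < 0) {r : ℝ} (hr : 0 ≤ r) :
    ‖resolventTerm τ r‖ ≤ (τ.im ^ 2)⁻¹ * r := by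
  rw [resolventTerm_eq hτ hr]
  have h1 : |τ.im| ≤ ‖τ‖ := Complex.abs_im_le_norm τ
  have h2 : |τ.im| ≤ ‖Complex.I * r - τ‖ := by
    refine le_trans ?_ (Complex.abs_im_le_norm _)
    simp only [Complex.sub_im, Complex.mul_im, Complex.I_re, Complex.I_im, Complex.ofReal_re,
      Complex.ofReal_im]
    rw [abs_of_neg hτ]
    refine le_trans ?_ (le_abs_self _)
    linarith
  have h3 : 0 < |τ.im| := abs_pos.2 hτ.ne
  rw [norm_mul, norm_mul, norm_mul, norm_inv, norm_inv, ← sq_abs]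
  simp only [Complex.norm_I, one_mul, Complex.norm_real, Real.norm_of_nonneg hr]
  rw [mul_comm, sq, mul_inv]
  gcongr

/-- In an eigenbasis of `V` the trace formula becomes a scalar identity. -/
lemma mem_spectralShiftFunctions_iff (hV : 0 ≤ V) (hb : ∀ i, V (b i) = (a i : ℂ) • b i)
    (ha : ∀ i, 0 ≤ a i) (hs : Summable a) (ω : ℝ → ℂ) :
    ω ∈ spectralShiftFunctions (Complex.I • V) 0 ↔
      Integrable (fun t : ℝ => ω t / (1 + (t : ℂ) ^ 2)) ∧
      ∀ τ : ℂ, τ.im < 0 →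
        HasSum (fun i => resolventTerm τ (a i)) (-∫ t : ℝ, ω t / ((t : ℂ) - τ) ^ 2) := by
  refine and_congr_right fun _ => forall₂_congr fun τ hτ => ?_
  have hτ0 : τ ≠ 0 := by rintro rfl; simp at hτ
  have hdiag : ∀ i, (Ring.inverse (Complex.I • V - τ • (1 : H →L[ℂ] H)) -
      Ring.inverse (0 - τ • (1 : H →L[ℂ] H))) (b i) = resolventTerm τ (a i) • b i := by
    intro i
    rw [sub_apply,
      ringInverse_sub_smul_apply (l := Complex.I * a i) (mem_resolventSet_I_smul hV hτ) ?_ ?_,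
      ringInverse_sub_smul_apply (l := 0) (mem_resolventSet_zero hτ0) hτ0.symm (by simp),
      resolventTerm, add_smul]
    · simp
    · intro h
      have := congrArg Complex.im h
      simp at this
      linarith [ha i]
    · rw [smul_apply, hb, smul_smul]
  have hsum : Summable fun i => ‖resolventTerm τ (a i)‖ :=
    .of_nonneg_of_le (fun _ => norm_nonneg _) (fun i => norm_resolventTerm_le hτ (ha i))
      (hs.mul_left _)
  have htr := hasTrace_of_diagonal b hdiag hsum
  constructor
  · rintro ⟨-, -, h⟩
    rw [h.unique htr]
    exact hsum.of_norm.hasSum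
  · intro h
    refine ⟨mem_resolventSet_I_smul hV hτ, mem_resolventSet_zero hτ0, ?_⟩
    rwa [← h.tsum_eq]

omit [CompleteSpace H] in
/-- The diagonal entries of `V` in an eigenbasis form an eigenvalue family of `V`, and those equal
to a given nonzero number are finite in number. -/
lemma isEigenvalueFamily_of_diagonal (hV : 0 ≤ V) (hb : ∀ i, V (b i) = (a i : ℂ) • b i) (hs : Summable a) :
    IsEigenvalueFamily V a ∧ ∀ μ : ℝ, μ ≠ 0 → {i | a i = μ}.Finite := by
  have hfin : ∀ μ : ℝ, μ ≠ 0 → {i | a i = μ}.Finite := fun μ hμ => by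
    simpa [Filter.eventually_cofinite] using hs.tendsto_cofinite_zero.eventually_ne hμ.symm
  refine ⟨fun μ hμ => ?_, hfin⟩
  have hsymm := ((ContinuousLinearMap.nonneg_iff_isPositive V).1 hV).isSymmetric
  have hspan : Module.End.eigenspace (V : H →ₗ[ℂ] H) (μ : ℂ) =
      Submodule.span ℂ (b '' {i | a i = μ}) := by
    apply le_antisymm
    · intro x hx
      replace hx : V x = (μ : ℂ) • x := Module.End.mem_eigenspace_iff.1 hx
      have h0 : ∀ i ∉ (hfin μ hμ).toFinset, b.repr x i • b i = 0 := by
        intro i hi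
        replace hi : a i ≠ μ := by simpa using hi
        have h1 : inner ℂ (V (b i)) x = inner ℂ (b i) (V x) := hsymm (b i) x
        rw [hx, hb, inner_smul_left, inner_smul_right, Complex.conj_ofReal, ← sub_eq_zero,
          ← sub_mul, mul_eq_zero, ← Complex.ofReal_sub, Complex.ofReal_eq_zero, sub_eq_zero] at h1
        rw [b.repr_apply_apply, h1.resolve_left hi, zero_smul]
      rw [(b.hasSum_repr x).unique (hasSum_sum_of_ne_finset_zero h0)]
      refine Submodule.sum_mem _ fun i hi => Submodule.smul_mem _ _ (Submodule.subset_span ?_)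
      exact ⟨i, by simpa using hi, rfl⟩
    · rw [Submodule.span_le]
      rintro _ ⟨i, hi, rfl⟩
      exact Module.End.mem_eigenspace_iff.2 (by rw [← hi]; exact hb i)
  have hinj : Function.Injective b := b.orthonormal.linearIndependent.injective
  rw [hspan, rank_span_set (b.orthonormal.linearIndependent.linearIndepOn_id.mono
    (Set.image_subset_range _ _)), ← hinj.encard_image]
  rfl

/-- The fibre of `f` over a nonzero number, seen inside the set where `f` does not vanish. -/
def nonzeroFiberEquiv {X : Type*} (f : X → ℝ) (c : {μ : ℝ // μ ≠ 0}) :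
    {x : {x // f x ≠ 0} // (⟨f x, x.2⟩ : {μ : ℝ // μ ≠ 0}) = c} ≃ {x | f x = c.1} where
  toFun x := ⟨x.1.1, congrArg Subtype.val x.2⟩
  invFun x := ⟨⟨x.1, by rw [show f x.1 = c.1 from x.2]; exact c.2⟩, Subtype.ext x.2⟩
  left_inv _ := rfl
  right_inv _ := rfl

lemma summable_comp_iff_restrict_ne_zero {X : Type*} (f : X → ℝ) {g : ℝ → ℝ} (hg : g 0 = 0) :
    (Summable fun x => g (f x)) ↔ Summable fun x : {x // f x ≠ 0} => g (f x) :=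
  (Subtype.val_injective.summable_iff fun x hx => by
    have : f x = 0 := by simpa using hx
    rw [this, hg]).symm

/-- Two families which take every nonzero value equally (and finitely) often have the same
summability properties. -/
lemma summable_comp_iff_of_encard_eq {ι : Type*} {α : ι → ℝ} {g : ℝ → ℝ} (hg : g 0 = 0)
    (hfin : ∀ μ : ℝ, μ ≠ 0 → {i | a i = μ}.Finite)
    (h : ∀ μ : ℝ, μ ≠ 0 → {n | α n = μ}.encard = {i | a i = μ}.encard) :
    (Summable fun n => g (α n)) ↔ Summable fun i => g (a i) := by
  have he : ∀ c : {μ : ℝ // μ ≠ 0}, Nonempty ({n | α n = c.1} ≃ {i | a i = c.1}) := fun c => by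
    have hf := hfin c.1 c.2
    have hf' : {n | α n = c.1}.Finite := by
      rw [← Set.encard_lt_top_iff, h c.1 c.2]; exact hf.encard_lt_top
    have := hf.to_subtype
    have := hf'.to_subtype
    refine Finite.card_eq.1 ?_
    rw [Nat.card_coe_set_eq, Nat.card_coe_set_eq, Set.ncard, Set.ncard, h c.1 c.2]
  let e := Equiv.ofFiberEquiv (f := fun n : {n // α n ≠ 0} => (⟨α n, n.2⟩ : {μ : ℝ // μ ≠ 0}))
    (g := fun i : {i // a i ≠ 0} => (⟨a i, i.2⟩ : {μ : ℝ // μ ≠ 0}))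
    fun c => (nonzeroFiberEquiv α c).trans ((he c).some.trans (nonzeroFiberEquiv a c).symm)
  have hmap : ∀ n, a (e n) = α n := fun n => congrArg Subtype.val (Equiv.ofFiberEquiv_map
    (f := fun n : {n // α n ≠ 0} => (⟨α n, n.2⟩ : {μ : ℝ // μ ≠ 0}))
    (g := fun i : {i // a i ≠ 0} => (⟨a i, i.2⟩ : {μ : ℝ // μ ≠ 0})) _ n)
  rw [summable_comp_iff_restrict_ne_zero α hg, summable_comp_iff_restrict_ne_zero a hg, ← e.summable_iff]
  simp only [Function.comp_def, hmap]

end Spectral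

/-! ### Cauchy and Poisson kernels on the real line -/

section CauchyKernels

open Filter Topology

/-- A complex number off the real axis is at a distance from `t` comparable to `√(1 + t²)`. -/
lemma exists_sqrt_one_add_sq_le (z : ℂ) (hz : z.im ≠ 0) :
    ∃ C : ℝ, 0 < C ∧ ∀ t : ℝ, √(1 + t ^ 2) ≤ C * ‖(t : ℂ) - z‖ := by
  have hz' : 0 < |z.im| := abs_pos.2 hz
  refine ⟨1 + (1 + ‖z‖) / |z.im|, by positivity, fun t => ?_⟩
  have h1 : |z.im| ≤ ‖(t : ℂ) - z‖ := by
    simpa using Complex.abs_im_le_norm ((t : ℂ) - z)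
  have h2 : |t| ≤ ‖(t : ℂ) - z‖ + ‖z‖ := by
    simpa using norm_add_le ((t : ℂ) - z) z
  have h3 : √(1 + t ^ 2) ≤ 1 + |t| := by
    rw [Real.sqrt_le_left (by positivity)]
    nlinarith [abs_nonneg t, sq_abs t]
  have h4 : (1 + ‖z‖) ≤ (1 + ‖z‖) / |z.im| * ‖(t : ℂ) - z‖ := by
    rw [div_mul_eq_mul_div, le_div_iff₀ hz']
    gcongr
  linarith

lemma exists_norm_inv_mul_inv_le {z w : ℂ} (hz : z.im ≠ 0) (hw : w.im ≠ 0) :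
    ∃ C : ℝ, ∀ t : ℝ, ‖((t : ℂ) - z)⁻¹ * ((t : ℂ) - w)⁻¹‖ ≤ C * (1 + t ^ 2)⁻¹ := by
  obtain ⟨C, hC, h1⟩ := exists_sqrt_one_add_sq_le z hz
  obtain ⟨D, hD, h2⟩ := exists_sqrt_one_add_sq_le w hw
  refine ⟨C * D, fun t => ?_⟩
  have h0 : 0 < √(1 + t ^ 2) := by positivity
  have key : ∀ (E x : ℝ), 0 < E → √(1 + t ^ 2) ≤ E * x → x⁻¹ ≤ E * (√(1 + t ^ 2))⁻¹ := by
    intro E x hE h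
    have hx : 0 < x := pos_of_mul_pos_right (h0.trans_le h) hE.le
    rw [inv_le_iff_one_le_mul₀ hx, mul_right_comm, ← div_eq_mul_inv, one_le_div h0]
    exact h
  rw [norm_mul, norm_inv, norm_inv]
  calc ‖(t : ℂ) - z‖⁻¹ * ‖(t : ℂ) - w‖⁻¹
      ≤ (C * (√(1 + t ^ 2))⁻¹) * (D * (√(1 + t ^ 2))⁻¹) := by
        gcongr
        · exact key C _ hC (h1 t)
        · exact key D _ hD (h2 t)
    _ = C * D * (1 + t ^ 2)⁻¹ := by
        rw [mul_mul_mul_comm, ← mul_inv, Real.mul_self_sqrt (by positivity)]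

lemma ofReal_sub_ne_zero {z : ℂ} (hz : z.im ≠ 0) (t : ℝ) : (t : ℂ) - z ≠ 0 := fun h => by
  apply hz
  have := congrArg Complex.im h
  simpa using this

lemma continuous_inv_ofReal_sub {z : ℂ} (hz : z.im ≠ 0) :
    Continuous fun t : ℝ => ((t : ℂ) - z)⁻¹ :=
  (by fun_prop : Continuous fun t : ℝ => (t : ℂ) - z).inv₀ (ofReal_sub_ne_zero hz)

lemma integrable_inv_mul_inv {z w : ℂ} (hz : z.im ≠ 0) (hw : w.im ≠ 0) :
    Integrable fun t : ℝ => ((t : ℂ) - z)⁻¹ * ((t : ℂ) - w)⁻¹ := by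
  obtain ⟨C, hC⟩ := exists_norm_inv_mul_inv_le hz hw
  exact (integrable_inv_one_add_sq.const_mul C).mono'
    ((continuous_inv_ofReal_sub hz).mul (continuous_inv_ofReal_sub hw)).aestronglyMeasurable
    (.of_forall hC)

lemma exists_norm_inv_le {z : ℂ} (hz : z.im ≠ 0) : ∃ C : ℝ, ∀ t : ℝ, ‖((t : ℂ) - z)⁻¹‖ ≤ C := by
  refine ⟨|z.im|⁻¹, fun t => ?_⟩
  rw [norm_inv]
  have := Complex.abs_im_le_norm ((t : ℂ) - z)
  simp only [Complex.sub_im, Complex.ofReal_im, zero_sub, abs_neg] at this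
  gcongr

lemma integrable_inv_mul_inv_sq {z w : ℂ} (hz : z.im ≠ 0) (hw : w.im ≠ 0) :
    Integrable fun t : ℝ => ((t : ℂ) - z)⁻¹ * (((t : ℂ) - w) ^ 2)⁻¹ := by
  obtain ⟨C, hC⟩ := exists_norm_inv_le hz
  refine ((integrable_inv_mul_inv hw hw).bdd_mul
    (continuous_inv_ofReal_sub hz).aestronglyMeasurable (.of_forall hC)).congr (.of_forall ?_)
  intro t
  simp only [sq, mul_inv]

lemma tendsto_inv_ofReal_sub (z : ℂ) {l : Filter ℝ} (hl : Tendsto (fun t : ℝ => |t|) l atTop) :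
    Tendsto (fun t : ℝ => ((t : ℂ) - z)⁻¹) l (𝓝 0) := by
  refine tendsto_inv₀_cobounded.comp (tendsto_norm_atTop_iff_cobounded.1 ?_)
  refine tendsto_atTop_mono (fun t => ?_) (tendsto_atTop_add_const_right _ (-‖z‖) hl)
  simpa [sub_eq_add_neg] using norm_sub_norm_le (t : ℂ) z

lemma tendsto_log_mul_sub {c : ℂ} (hc : c ∈ Complex.slitPlane) (z : ℂ) :
    Tendsto (fun t : ℝ => Complex.log (c * (t - z)) - Real.log t) atTop (𝓝 (Complex.log c)) := by
  have h1 : Tendsto (fun t : ℝ => c * (1 - z * ((t : ℂ) - 0)⁻¹)) atTop (𝓝 c) := by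
    have := ((tendsto_inv_ofReal_sub 0 tendsto_abs_atTop_atTop).const_mul z).const_sub 1
    simpa using this.const_mul c
  refine ((continuousAt_clog hc).tendsto.comp h1).congr' ?_
  have h2 : ∀ᶠ t : ℝ in atTop, c * (1 - z * ((t : ℂ) - 0)⁻¹) ∈ Complex.slitPlane :=
    h1.eventually (Complex.isOpen_slitPlane.mem_nhds hc)
  filter_upwards [h2, eventually_gt_atTop 0] with t ht ht0
  have h3 : c * (t - z) = (t : ℂ) * (c * (1 - z * ((t : ℂ) - 0)⁻¹)) := by
    have : (t : ℂ) ≠ 0 := by exact_mod_cast ht0.ne'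
    field_simp
    ring
  rw [h3, Complex.log_ofReal_mul ht0 (Complex.slitPlane_ne_zero ht)]
  simp

lemma tendsto_log_mul_sub_atBot {c : ℂ} (hc : -c ∈ Complex.slitPlane) (z : ℂ) :
    Tendsto (fun t : ℝ => Complex.log (c * (t - z)) - Real.log t) atBot
      (𝓝 (Complex.log (-c))) := by
  refine ((tendsto_log_mul_sub hc (-z)).comp tendsto_neg_atBot_atTop).congr fun t => ?_
  simp only [Function.comp, Complex.ofReal_neg, Real.log_neg_eq_log]
  congr 2
  ring

/-- Integration of `1 / ((t - a) (t - τ)²)` by partial fractions. The unimodular constants `c`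
and `-i` rotate the lines `t - a` and `t - τ` into the domain of the principal logarithm. -/
lemma integral_inv_mul_inv_sq_of_ne {a τ c : ℂ} (ha : a.im ≠ 0) (hτ : τ.im < 0) (hne : a ≠ τ)
    (hc : c ∈ Complex.slitPlane) (hc' : -c ∈ Complex.slitPlane)
    (hca : ∀ t : ℝ, c * (t - a) ∈ Complex.slitPlane) :
    ∫ t : ℝ, ((t : ℂ) - a)⁻¹ * (((t : ℂ) - τ) ^ 2)⁻¹ =
      ((a - τ) ^ 2)⁻¹ * ((Complex.log c - Complex.log (-Complex.I)) -
        (Complex.log (-c) - Complex.log Complex.I)) := by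
  have hIτ : ∀ t : ℝ, -Complex.I * (t - τ) ∈ Complex.slitPlane := fun t => by
    left; simpa using hτ
  have hI : -Complex.I ∈ Complex.slitPlane := by right; simp
  have hI' : -(-Complex.I) ∈ Complex.slitPlane := by right; simp
  have hc0 : c ≠ 0 := Complex.slitPlane_ne_zero hc
  have hsub : a - τ ≠ 0 := sub_ne_zero.2 hne
  have hlog : ∀ {d w : ℂ}, d ≠ 0 → ∀ t : ℝ, d * (t - w) ∈ Complex.slitPlane →
      HasDerivAt (fun t : ℝ => Complex.log (d * (t - w))) ((t : ℂ) - w)⁻¹ t := by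
    intro d w hd t ht
    have h := (((Complex.ofRealCLM.hasDerivAt (x := t)).sub_const w).const_mul d).clog_real ht
    refine h.congr_deriv ?_
    simp only [Complex.ofRealCLM_apply, Complex.ofReal_one, mul_one]
    rw [← div_div, div_self hd, one_div]
  have hinv : ∀ t : ℝ, HasDerivAt (fun t : ℝ => ((t : ℂ) - τ)⁻¹) (-(((t : ℂ) - τ) ^ 2)⁻¹) t := by
    intro t
    have h := ((Complex.ofRealCLM.hasDerivAt (x := t)).sub_const τ).fun_inv
      (ofReal_sub_ne_zero hτ.ne t)
    refine h.congr_deriv ?_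
    simp [neg_div]
  have hlim : ∀ {l : Filter ℝ} {x y : ℂ},
      Tendsto (fun t : ℝ => Complex.log (c * (t - a)) - Real.log t) l (𝓝 x) →
      Tendsto (fun t : ℝ => Complex.log (-Complex.I * (t - τ)) - Real.log t) l (𝓝 y) →
      Tendsto (fun t : ℝ => |t|) l atTop →
      Tendsto (fun t : ℝ => ((a - τ) ^ 2)⁻¹ *
        (Complex.log (c * (t - a)) - Complex.log (-Complex.I * (t - τ))) +
        (a - τ)⁻¹ * ((t : ℂ) - τ)⁻¹) l (𝓝 (((a - τ) ^ 2)⁻¹ * (x - y))) := by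
    intro l x y hx hy hl
    have := ((hx.sub hy).const_mul ((a - τ) ^ 2)⁻¹).add
      ((tendsto_inv_ofReal_sub τ hl).const_mul (a - τ)⁻¹)
    rw [mul_zero, add_zero] at this
    refine this.congr fun t => ?_
    ring
  rw [integral_of_hasDerivAt_of_tendsto (fun t => ?_) (integrable_inv_mul_inv_sq ha hτ.ne)
    (hlim (tendsto_log_mul_sub_atBot hc' a) (tendsto_log_mul_sub_atBot hI' τ)
      tendsto_abs_atBot_atTop)
    (hlim (tendsto_log_mul_sub hc a) (tendsto_log_mul_sub hI τ) tendsto_abs_atTop_atTop)]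
  · rw [neg_neg, mul_sub _ (_ - _)]
  · refine ((((hlog hc0 t (hca t)).sub (hlog (neg_ne_zero.2 Complex.I_ne_zero) t
      (hIτ t))).const_mul _).add ((hinv t).const_mul _)).congr_deriv ?_
    have h1 := ofReal_sub_ne_zero ha t
    have h2 := ofReal_sub_ne_zero hτ.ne t
    field_simp
    ring

lemma integral_inv_mul_inv_sq_of_im_pos {a τ : ℂ} (ha : 0 < a.im) (hτ : τ.im < 0) :
    ∫ t : ℝ, ((t : ℂ) - a)⁻¹ * (((t : ℂ) - τ) ^ 2)⁻¹ =
      2 * Real.pi * Complex.I * ((a - τ) ^ 2)⁻¹ := by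
  rw [integral_inv_mul_inv_sq_of_ne (c := Complex.I) ha.ne' hτ (by rintro rfl; linarith)
    (by right; simp) (by right; simp) (fun t => by left; simpa using ha), Complex.log_I,
    Complex.log_neg_I]
  ring

lemma integral_inv_mul_inv_sq_of_im_neg {a τ : ℂ} (ha : a.im < 0) (hτ : τ.im < 0) :
    ∫ t : ℝ, ((t : ℂ) - a)⁻¹ * (((t : ℂ) - τ) ^ 2)⁻¹ = 0 := by
  rcases eq_or_ne a τ with rfl | hne
  · -- a triple pole: the antiderivative is `-1 / (2 (t - a)²)`
    have hlim : ∀ {l : Filter ℝ}, Tendsto (fun t : ℝ => |t|) l atTop →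
        Tendsto (fun t : ℝ => -(1 / 2 : ℂ) * (((t : ℂ) - a)⁻¹) ^ 2) l (𝓝 0) := fun hl => by
      simpa using ((tendsto_inv_ofReal_sub a hl).pow 2).const_mul (-(1 / 2 : ℂ))
    rw [integral_of_hasDerivAt_of_tendsto (fun t => ?_) (integrable_inv_mul_inv_sq ha.ne ha.ne)
      (hlim tendsto_abs_atBot_atTop) (hlim tendsto_abs_atTop_atTop), sub_zero]
    have h := ((((Complex.ofRealCLM.hasDerivAt (x := t)).sub_const a).fun_inv
      (ofReal_sub_ne_zero ha.ne t)).fun_pow 2).const_mul (-(1 / 2 : ℂ))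
    refine h.congr_deriv ?_
    have := ofReal_sub_ne_zero ha.ne t
    simp
    field_simp
  · rw [integral_inv_mul_inv_sq_of_ne (c := -Complex.I) ha.ne hτ hne
      (by right; simp) (by right; simp) (fun t => by left; simpa using ha), neg_neg]
    ring

/-- The Poisson kernel and the conjugate Poisson kernel at the point `i s` have, up to a factor
`i`, the same integral against `(t - τ)⁻²` when `τ` lies in the lower half plane: they differ by
a multiple of `(t + i s)⁻¹`, whose only pole is in the lower half plane too. -/
lemma integral_conjPoisson_div_sq {s : ℝ} (hs : 0 < s) {τ : ℂ} (hτ : τ.im < 0) :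
    ∫ t : ℝ, ((t / (t ^ 2 + s ^ 2) : ℝ) : ℂ) / ((t : ℂ) - τ) ^ 2 =
      Real.pi * Complex.I * ((Complex.I * s - τ) ^ 2)⁻¹ := by
  have h1 : 0 < (Complex.I * s).im := by simpa using hs
  have h2 : (-(Complex.I * s)).im < 0 := by simpa using hs
  have e : ∀ t : ℝ, ((t / (t ^ 2 + s ^ 2) : ℝ) : ℂ) / ((t : ℂ) - τ) ^ 2 =
      2⁻¹ * (((t : ℂ) - Complex.I * s)⁻¹ * (((t : ℂ) - τ) ^ 2)⁻¹ +
        ((t : ℂ) - -(Complex.I * s))⁻¹ * (((t : ℂ) - τ) ^ 2)⁻¹) := fun t => by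
    have n1 := ofReal_sub_ne_zero h1.ne' t
    have n2 := ofReal_sub_ne_zero h2.ne t
    have n3 : ((t : ℂ) ^ 2 + (s : ℂ) ^ 2) =
        ((t : ℂ) - Complex.I * s) * ((t : ℂ) - -(Complex.I * s)) := by
      linear_combination (s : ℂ) ^ 2 * Complex.I_sq
    push_cast
    rw [n3, div_eq_mul_inv _ (((t : ℂ) - τ) ^ 2), ← add_mul, ← mul_assoc]
    congr 1
    field_simp
    ring
  simp_rw [e]
  rw [integral_const_mul, integral_add (integrable_inv_mul_inv_sq h1.ne' hτ.ne)
    (integrable_inv_mul_inv_sq h2.ne hτ.ne), integral_inv_mul_inv_sq_of_im_pos h1 hτ,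
    integral_inv_mul_inv_sq_of_im_neg h2 hτ]
  ring

lemma integral_poisson_div_sq {s : ℝ} (hs : 0 < s) {τ : ℂ} (hτ : τ.im < 0) :
    ∫ t : ℝ, (Complex.I * ((s / (t ^ 2 + s ^ 2) : ℝ) : ℂ)) / ((t : ℂ) - τ) ^ 2 =
      Real.pi * Complex.I * ((Complex.I * s - τ) ^ 2)⁻¹ := by
  have h1 : 0 < (Complex.I * s).im := by simpa using hs
  have h2 : (-(Complex.I * s)).im < 0 := by simpa using hs
  have e : ∀ t : ℝ, (Complex.I * ((s / (t ^ 2 + s ^ 2) : ℝ) : ℂ)) / ((t : ℂ) - τ) ^ 2 =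
      2⁻¹ * (((t : ℂ) - Complex.I * s)⁻¹ * (((t : ℂ) - τ) ^ 2)⁻¹ -
        ((t : ℂ) - -(Complex.I * s))⁻¹ * (((t : ℂ) - τ) ^ 2)⁻¹) := fun t => by
    have n1 := ofReal_sub_ne_zero h1.ne' t
    have n2 := ofReal_sub_ne_zero h2.ne t
    have n3 : ((t : ℂ) ^ 2 + (s : ℂ) ^ 2) =
        ((t : ℂ) - Complex.I * s) * ((t : ℂ) - -(Complex.I * s)) := by
      linear_combination (s : ℂ) ^ 2 * Complex.I_sq
    push_cast
    rw [n3, div_eq_mul_inv _ (((t : ℂ) - τ) ^ 2), ← sub_mul, ← mul_assoc]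
    congr 1
    field_simp
    ring
  simp_rw [e]
  rw [integral_const_mul, integral_sub (integrable_inv_mul_inv_sq h1.ne' hτ.ne)
    (integrable_inv_mul_inv_sq h2.ne hτ.ne), integral_inv_mul_inv_sq_of_im_pos h1 hτ,
    integral_inv_mul_inv_sq_of_im_neg h2 hτ]
  ring

/-- Integrability against `(1 + t²)⁻¹` gives integrability against `(t - τ)⁻²`. -/
lemma integrable_div_ofReal_sub_sq {X : Type*} [MeasurableSpace X] {μ : Measure X} {f : X → ℂ}
    {g : X → ℝ} (hg : Measurable g) (hf : Integrable (fun x => f x / (1 + (g x : ℂ) ^ 2)) μ)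
    {τ : ℂ} (hτ : τ.im ≠ 0) : Integrable (fun x => f x / ((g x : ℂ) - τ) ^ 2) μ := by
  obtain ⟨C, hC⟩ := exists_norm_inv_mul_inv_le hτ hτ
  have hcont : Continuous fun t : ℝ =>
      (1 + (t : ℂ) ^ 2) * (((t : ℂ) - τ)⁻¹ * ((t : ℂ) - τ)⁻¹) :=
    (by fun_prop : Continuous fun t : ℝ => (1 + (t : ℂ) ^ 2)).mul
      ((continuous_inv_ofReal_sub hτ).mul (continuous_inv_ofReal_sub hτ))
  have hnorm : ∀ t : ℝ, ‖(1 + (t : ℂ) ^ 2)‖ = 1 + t ^ 2 := fun t => by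
    rw [show (1 + (t : ℂ) ^ 2) = ((1 + t ^ 2 : ℝ) : ℂ) by push_cast; rfl, Complex.norm_real,
      Real.norm_of_nonneg (by positivity)]
  refine (hf.bdd_mul (c := C) (hcont.measurable.comp hg).aestronglyMeasurable
    (.of_forall fun x => ?_)).congr (.of_forall fun x => ?_)
  · simp only [Function.comp]
    rw [norm_mul, hnorm]
    have h0 : 0 < 1 + g x ^ 2 := by positivity
    calc (1 + g x ^ 2) * ‖((g x : ℂ) - τ)⁻¹ * ((g x : ℂ) - τ)⁻¹‖
        ≤ (1 + g x ^ 2) * (C * (1 + g x ^ 2)⁻¹) := by gcongr; exact hC _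
      _ = C := by field_simp
  · have h0 : (1 + (g x : ℂ) ^ 2) ≠ 0 := by
      rw [← norm_ne_zero_iff, hnorm]; positivity
    have := ofReal_sub_ne_zero hτ (g x)
    simp only [Function.comp]
    field_simp

end CauchyKernels

/-! ### Construction of spectral shift functions -/

section ShiftFunctions

open Filter Topology Set

variable {κ : Type*} {a : κ → ℝ}

lemma lintegral_poisson {s : ℝ} (hs : 0 < s) :
    ∫⁻ t : ℝ, ENNReal.ofReal (s / (t ^ 2 + s ^ 2)) = ENNReal.ofReal Real.pi := by
  have e : (fun t : ℝ => s / (t ^ 2 + s ^ 2)) = fun t => s⁻¹ * (1 + (t / s) ^ 2)⁻¹ := by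
    ext t; field_simp; ring
  have hi : Integrable fun t : ℝ => s / (t ^ 2 + s ^ 2) := by
    rw [e]
    exact (integrable_inv_one_add_sq.comp_div hs.ne').const_mul _
  rw [← ofReal_integral_eq_lintegral_ofReal hi (.of_forall fun t => by positivity), e,
    integral_const_mul, Measure.integral_comp_div (fun t : ℝ => (1 + t ^ 2)⁻¹) s,
    integral_univ_inv_one_add_sq, abs_of_pos hs, smul_eq_mul, inv_mul_cancel_left₀ hs.ne']

lemma summable_sq_of_summable (ha : ∀ i, 0 ≤ a i) (hs : Summable a) :
    Summable fun i => a i ^ 2 :=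
  .of_nonneg_of_le (fun _ => by positivity)
    (fun i => by rw [sq]; exact mul_le_mul_of_nonneg_right (hs.le_tsum i fun j _ => ha j) (ha i))
    (hs.mul_left (∑' i, a i))

/-- The measure `#{i | aᵢ ≥ s} ds` on the half line. -/
noncomputable def countingFunctionMeasure (a : κ → ℝ) : Measure ℝ :=
  Measure.sum fun i => volume.restrict (Ioc 0 (a i))

lemma integral_resolventTerm {τ : ℂ} (hτ : τ.im < 0) {r : ℝ} (hr : 0 ≤ r) :
    ∫ s in Ioc 0 r, Complex.I * ((Complex.I * s - τ) ^ 2)⁻¹ = -resolventTerm τ r := by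
  have hne : ∀ s : ℝ, 0 ≤ s → Complex.I * s - τ ≠ 0 := fun s hs h => by
    have := congrArg Complex.im h
    simp at this; linarith
  rw [← intervalIntegral.integral_of_le hr,
    intervalIntegral.integral_eq_sub_of_hasDerivAt
      (f := fun s : ℝ => -(Complex.I * s - τ)⁻¹)]
  · simp [resolventTerm]; ring
  · intro s hs
    rw [uIcc_of_le hr] at hs
    have h := ((((Complex.ofRealCLM.hasDerivAt (x := s)).const_mul Complex.I).sub_const τ).fun_inv
      (hne s hs.1)).neg
    refine h.congr_deriv ?_
    simp [div_eq_mul_inv]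
  · apply ContinuousOn.intervalIntegrable
    rw [uIcc_of_le hr]
    refine continuousOn_const.mul (ContinuousOn.inv₀ (by fun_prop) fun s hs => ?_)
    exact pow_ne_zero 2 (hne s hs.1)

variable [Countable κ]

instance : SFinite (countingFunctionMeasure a) := by
  unfold countingFunctionMeasure; infer_instance

lemma ae_countingFunctionMeasure_pos : ∀ᵐ s ∂countingFunctionMeasure a, 0 < s := by
  rw [countingFunctionMeasure, Measure.ae_sum_iff]
  exact fun i => (ae_restrict_mem measurableSet_Ioc).mono fun s hs => hs.1

/-- Superposition of kernels: if `k s` represents the derivative at `s` of the trace of the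
resolvent difference, its integral over `0 < s ≤ aᵢ`, summed over `i`, is a spectral shift
function. -/
lemma hasSum_resolventTerm_of_kernel (ha : ∀ i, 0 ≤ a i) {k : ℝ → ℝ → ℂ}
    (hk : Integrable (fun p : ℝ × ℝ => k p.1 p.2 / (1 + (p.2 : ℂ) ^ 2))
      ((countingFunctionMeasure a).prod volume))
    (hint : ∀ s : ℝ, 0 < s → ∀ τ : ℂ, τ.im < 0 → ∫ t : ℝ, k s t / ((t : ℂ) - τ) ^ 2 =
      Real.pi * Complex.I * ((Complex.I * s - τ) ^ 2)⁻¹) {ω : ℝ → ℂ}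
    (hω : ∀ t, ω t = (∫ s, k s t ∂countingFunctionMeasure a) / Real.pi) :
    Integrable (fun t : ℝ => ω t / (1 + (t : ℂ) ^ 2)) ∧
      ∀ τ : ℂ, τ.im < 0 →
        HasSum (fun i => resolventTerm τ (a i)) (-∫ t : ℝ, ω t / ((t : ℂ) - τ) ^ 2) := by
  have hπ : (Real.pi : ℂ) ≠ 0 := by exact_mod_cast Real.pi_ne_zero
  constructor
  · refine (hk.integral_prod_right.div_const (Real.pi : ℂ)).congr (.of_forall fun t => ?_)
    simp only [hω, integral_div]
    ring
  · intro τ hτ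
    have hk' : Integrable (fun p : ℝ × ℝ => k p.1 p.2 / ((p.2 : ℂ) - τ) ^ 2)
        ((countingFunctionMeasure a).prod volume) :=
      integrable_div_ofReal_sub_sq measurable_snd hk hτ.ne
    have hg : (fun s : ℝ => ∫ t : ℝ, k s t / ((t : ℂ) - τ) ^ 2)
        =ᵐ[countingFunctionMeasure a]
          fun s => Real.pi * (Complex.I * ((Complex.I * s - τ) ^ 2)⁻¹) := by
      filter_upwards [ae_countingFunctionMeasure_pos] with s hs
      rw [hint s hs τ hτ, mul_assoc]
    have hgi : Integrable (fun s : ℝ => Complex.I * ((Complex.I * s - τ) ^ 2)⁻¹)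
        (countingFunctionMeasure a) := by
      have h := (hk'.integral_prod_left.congr hg).const_mul ((Real.pi : ℂ)⁻¹)
      refine h.congr (.of_forall fun s => ?_)
      simp only
      rw [inv_mul_cancel_left₀ hπ]
    have hval : ∫ t : ℝ, ω t / ((t : ℂ) - τ) ^ 2 =
        ∫ s, Complex.I * ((Complex.I * s - τ) ^ 2)⁻¹ ∂countingFunctionMeasure a := by
      have h1 : ∀ t : ℝ, ω t / ((t : ℂ) - τ) ^ 2 =
          (∫ s, k s t / ((t : ℂ) - τ) ^ 2 ∂countingFunctionMeasure a) / Real.pi := fun t => by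
        rw [hω, integral_div]; ring
      simp_rw [h1]
      rw [integral_div, ← integral_integral_swap hk', integral_congr_ae hg, integral_const_mul,
        mul_div_cancel_left₀ _ hπ]
    rw [hval]
    have h := (hasSum_integral_measure hgi).neg
    refine h.congr_fun fun i => ?_
    rw [integral_resolventTerm hτ (ha i), neg_neg]

lemma integrable_prod_countingFunctionMeasure {k : ℝ → ℝ → ℝ} {c : ℂ} {M : ℝ → ℝ}
    (hk : Measurable fun p : ℝ × ℝ => k p.1 p.2)
    (hM : Integrable M (countingFunctionMeasure a))
    (hkM : ∀ s : ℝ, 0 < s →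
      ∫⁻ t : ℝ, ENNReal.ofReal (|k s t| / (1 + t ^ 2)) ≤ ENNReal.ofReal (M s)) :
    Integrable (fun p : ℝ × ℝ => (c * (k p.1 p.2 : ℂ)) / (1 + (p.2 : ℂ) ^ 2))
      ((countingFunctionMeasure a).prod volume) := by
  have hmeas : Measurable fun p : ℝ × ℝ => k p.1 p.2 / (1 + p.2 ^ 2) := by fun_prop
  have h : Integrable (fun p : ℝ × ℝ => k p.1 p.2 / (1 + p.2 ^ 2))
      ((countingFunctionMeasure a).prod volume) := by
    refine ⟨hmeas.aestronglyMeasurable, ?_⟩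
    rw [HasFiniteIntegral, lintegral_prod _ hmeas.enorm.aemeasurable]
    refine lt_of_le_of_lt (lintegral_mono_ae ?_) (hM.lintegral_lt_top)
    filter_upwards [ae_countingFunctionMeasure_pos] with s hs
    refine le_trans (le_of_eq (lintegral_congr fun t => ?_)) (hkM s hs)
    rw [Real.enorm_eq_ofReal_abs, abs_div, abs_of_pos (by positivity : 0 < 1 + t ^ 2)]
  refine (h.ofReal (𝕜 := ℂ)).const_mul c |>.congr (.of_forall fun p => ?_)
  simp only [Complex.coe_algebraMap]
  push_cast
  rw [mul_div_assoc]

/-- The superposition of Poisson kernels, `(i/2π) ∑ log (1 + aᵢ²/t²)`, is a purely imaginary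
spectral shift function. -/
lemma exists_imaginary_shift (ha : ∀ i, 0 ≤ a i) (hs : Summable a) :
    ∃ ω : ℝ → ℂ, (Integrable (fun t : ℝ => ω t / (1 + (t : ℂ) ^ 2)) ∧
      ∀ τ : ℂ, τ.im < 0 →
        HasSum (fun i => resolventTerm τ (a i)) (-∫ t : ℝ, ω t / ((t : ℂ) - τ) ^ 2)) ∧
      ∀ t, (ω t).re = 0 := by
  have hM : Integrable (fun _ : ℝ => Real.pi) (countingFunctionMeasure a) := by
    refine integrable_sum_measure (fun i => by simp) ?_
    simpa [abs_of_pos Real.pi_pos, ha] using hs.mul_right Real.pi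
  have hk := integrable_prod_countingFunctionMeasure (k := fun s t => s / (t ^ 2 + s ^ 2))
    (c := Complex.I) (by fun_prop) hM fun s hs => by
      rw [← lintegral_poisson hs]
      refine lintegral_mono fun t => ENNReal.ofReal_le_ofReal ?_
      rw [abs_of_pos (by positivity)]
      exact div_le_self (by positivity) (by nlinarith [sq_nonneg t])
  refine ⟨_, hasSum_resolventTerm_of_kernel ha hk
    (fun s hs τ hτ => integral_poisson_div_sq hs hτ) fun t => rfl, fun t => ?_⟩
  rw [integral_const_mul, integral_complex_ofReal, mul_div_assoc, ← Complex.ofReal_div]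
  simp

lemma lintegral_conjPoisson_le {s : ℝ} (hs : 0 < s) :
    ∫⁻ t : ℝ, ENNReal.ofReal (|t / (t ^ 2 + s ^ 2)| / (1 + t ^ 2)) ≤
      ENNReal.ofReal (2 * s - 2 * Real.log s + Real.pi) := by
  have hpos : ∀ t : ℝ, 0 < t ^ 2 + s ^ 2 := fun t => by positivity
  have hcont : Continuous fun t : ℝ => |t| / (t ^ 2 + s ^ 2) :=
    Continuous.div (by fun_prop) (by fun_prop) fun t => (hpos t).ne'
  set F : ℝ → ℝ := fun t => (Ioc (-1) 1).indicator (fun t => |t| / (t ^ 2 + s ^ 2)) t +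
    (1 + t ^ 2)⁻¹ with hF
  have hi : IntegrableOn (fun t : ℝ => |t| / (t ^ 2 + s ^ 2)) (Ioc (-1) 1) :=
    (hcont.integrableOn_Icc).mono_set Ioc_subset_Icc_self
  have hFi : Integrable F :=
    (hi.integrable_indicator measurableSet_Ioc).add integrable_inv_one_add_sq
  have hle : ∀ t : ℝ, |t / (t ^ 2 + s ^ 2)| / (1 + t ^ 2) ≤ F t := by
    intro t
    rw [abs_div, abs_of_pos (hpos t)]
    by_cases ht : t ∈ Ioc (-1 : ℝ) 1
    · simp only [hF, indicator_of_mem ht]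
      have : |t| / (t ^ 2 + s ^ 2) / (1 + t ^ 2) ≤ |t| / (t ^ 2 + s ^ 2) :=
        div_le_self (by positivity) (by nlinarith [sq_nonneg t])
      have : 0 < (1 + t ^ 2)⁻¹ := by positivity
      linarith
    · simp only [hF, indicator_of_notMem ht, zero_add]
      have h1 : 1 ≤ |t| := by
        by_contra hc
        push Not at hc
        exact ht ⟨(abs_lt.1 hc).1, (abs_lt.1 hc).2.le⟩
      rw [inv_eq_one_div]
      gcongr
      rw [div_le_one (hpos t)]
      nlinarith [sq_abs t, sq_nonneg s]
  have hnn : ∀ t : ℝ, 0 ≤ F t := fun t => le_trans (by positivity) (hle t)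
  refine (lintegral_mono fun t => ENNReal.ofReal_le_ofReal (hle t)).trans ?_
  rw [← ofReal_integral_eq_lintegral_ofReal hFi (.of_forall hnn)]
  apply ENNReal.ofReal_le_ofReal
  rw [hF, integral_add (hi.integrable_indicator measurableSet_Ioc) integrable_inv_one_add_sq,
    integral_univ_inv_one_add_sq, integral_indicator measurableSet_Ioc,
    ← intervalIntegral.integral_of_le (by norm_num)]
  have hderiv : ∀ t : ℝ, HasDerivAt (fun t : ℝ => Real.log (t ^ 2 + s ^ 2) / 2)
      (t / (t ^ 2 + s ^ 2)) t := fun t => by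
    refine (((((hasDerivAt_id t).pow 2).add_const (s ^ 2)).log (hpos t).ne').div_const 2
      ).congr_deriv ?_
    simp
    field_simp
  have hcont' : Continuous fun t : ℝ => t / (t ^ 2 + s ^ 2) :=
    Continuous.div (by fun_prop) (by fun_prop) fun t => (hpos t).ne'
  have h1 : ∫ t in (0 : ℝ)..1, |t| / (t ^ 2 + s ^ 2) =
      (Real.log (1 + s ^ 2) - Real.log (s ^ 2)) / 2 := by
    rw [intervalIntegral.integral_congr (g := fun t => t / (t ^ 2 + s ^ 2)),
      intervalIntegral.integral_eq_sub_of_hasDerivAt (fun t _ => hderiv t)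
        (hcont'.intervalIntegrable _ _)]
    · simp; ring
    · intro t ht
      rw [uIcc_of_le zero_le_one] at ht
      simp only [abs_of_nonneg ht.1]
  have h2 : ∫ t in (-1 : ℝ)..0, |t| / (t ^ 2 + s ^ 2) =
      (Real.log (1 + s ^ 2) - Real.log (s ^ 2)) / 2 := by
    rw [← h1]
    have := intervalIntegral.integral_comp_neg (a := 0) (b := 1)
      (fun t : ℝ => |t| / (t ^ 2 + s ^ 2))
    simp only [abs_neg, neg_zero, even_two, Even.neg_pow] at this
    exact this.symm
  rw [← intervalIntegral.integral_add_adjacent_intervals (b := 0) (hcont.intervalIntegrable _ _)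
    (hcont.intervalIntegrable _ _), h1, h2, Real.log_pow]
  have h3 : Real.log (1 + s ^ 2) ≤ 2 * s := by
    rw [Real.log_le_iff_le_exp (by positivity)]
    have := Real.quadratic_le_exp_of_nonneg (x := 2 * s) (by positivity)
    nlinarith [sq_nonneg s]
  push_cast
  linarith

/-- The superposition of conjugate Poisson kernels, `π⁻¹ ∑ arctan (aᵢ/t)`, is a real spectral
shift function as soon as it is absolutely integrable. -/
lemma exists_real_shift (ha : ∀ i, 0 ≤ a i) (hs : Summable a)
    (hlog : Summable fun i => a i * |Real.log (a i)|) :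
    ∃ ω : ℝ → ℂ, (Integrable (fun t : ℝ => ω t / (1 + (t : ℂ) ^ 2)) ∧
      ∀ τ : ℂ, τ.im < 0 →
        HasSum (fun i => resolventTerm τ (a i)) (-∫ t : ℝ, ω t / ((t : ℂ) - τ) ^ 2)) ∧
      ∀ t, (ω t).im = 0 := by
  have hM : Integrable (fun s : ℝ => 2 * s - 2 * Real.log s + Real.pi)
      (countingFunctionMeasure a) := by
    have hii : ∀ r : ℝ, IntervalIntegrable (fun s : ℝ => 2 * s - 2 * Real.log s + Real.pi)
        volume 0 r := fun r =>
      (((continuous_const.mul continuous_id).intervalIntegrable _ _).sub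
        (intervalIntegral.intervalIntegrable_log'.const_mul 2)).add
        intervalIntegrable_const
    refine integrable_sum_measure
      (fun i => (intervalIntegrable_iff_integrableOn_Ioc_of_le (ha i)).1 (hii _)) ?_
    have hval : ∀ i, ∫ s in Ioc 0 (a i), ‖2 * s - 2 * Real.log s + Real.pi‖ =
        a i ^ 2 - 2 * (a i * Real.log (a i)) + (2 + Real.pi) * a i := by
      intro i
      have h1 : ∫ s in Ioc 0 (a i), ‖2 * s - 2 * Real.log s + Real.pi‖ =
          ∫ s in Ioc 0 (a i), (2 * s - 2 * Real.log s + Real.pi) := by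
        refine setIntegral_congr_fun measurableSet_Ioc fun s hs => ?_
        refine Real.norm_of_nonneg ?_
        have := Real.log_le_sub_one_of_pos hs.1
        linarith [Real.pi_pos]
      rw [h1, ← intervalIntegral.integral_of_le (ha i), intervalIntegral.integral_add,
        intervalIntegral.integral_sub, intervalIntegral.integral_const_mul,
        intervalIntegral.integral_const_mul, integral_log, integral_id,
        intervalIntegral.integral_const]
      · simp; ring
      · exact (continuous_const.mul continuous_id).intervalIntegrable _ _
      · exact intervalIntegral.intervalIntegrable_log'.const_mul 2
      · exact ((continuous_const.mul continuous_id).intervalIntegrable _ _).sub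
          (intervalIntegral.intervalIntegrable_log'.const_mul 2)
      · exact intervalIntegrable_const
    simp_rw [hval]
    have hlog' : Summable fun i => a i * Real.log (a i) :=
      hlog.of_norm_bounded fun i => by rw [norm_mul, Real.norm_of_nonneg (ha i), Real.norm_eq_abs]
    exact ((summable_sq_of_summable ha hs).sub (hlog'.mul_left 2)).add (hs.mul_left _)
  have hk := integrable_prod_countingFunctionMeasure (k := fun s t => t / (t ^ 2 + s ^ 2))
    (c := 1) (by fun_prop) hM fun s hs => lintegral_conjPoisson_le hs
  simp only [one_mul] at hk
  refine ⟨_, hasSum_resolventTerm_of_kernel ha hk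
    (fun s hs τ hτ => integral_conjPoisson_div_sq hs hτ)
    fun t => rfl, fun t => ?_⟩
  rw [integral_complex_ofReal, ← Complex.ofReal_div, Complex.ofReal_im]

end ShiftFunctions

/-! ### Necessity of the logarithmic condition -/

section Necessity

open Filter Topology Set

variable {κ : Type*} {a : κ → ℝ}

lemma resolventTerm_neg_I_mul {y r : ℝ} (hy : 0 < y) (hr : 0 ≤ r) :
    resolventTerm (-(Complex.I * y)) r = Complex.I * ((r / (y * (r + y)) : ℝ) : ℂ) := by
  have h1 : (y : ℂ) ≠ 0 := by exact_mod_cast hy.ne'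
  have h2 : (r : ℂ) + y ≠ 0 := by
    exact_mod_cast (by positivity : r + y ≠ 0)
  rw [resolventTerm, sub_neg_eq_add, ← mul_add, mul_inv, inv_neg, mul_inv, Complex.inv_I]
  push_cast
  field_simp
  ring

/-- The conjugate-kernel test function: `y` times the imaginary part of `-(t + i y)⁻²`. -/
noncomputable def testKernel (t y : ℝ) : ℝ := 2 * t * y ^ 2 / (t ^ 2 + y ^ 2) ^ 2

lemma im_inv_add_I_mul_sq {t y : ℝ} (hy : 0 < y) :
    y * ((((t : ℂ) - -(Complex.I * y)) ^ 2)⁻¹).im = -testKernel t y := by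
  have h : (((t : ℂ) - -(Complex.I * y)) ^ 2)⁻¹ =
      (((t ^ 2 - y ^ 2) / (t ^ 2 + y ^ 2) ^ 2 : ℝ) : ℂ) +
        ((-(2 * t * y) / (t ^ 2 + y ^ 2) ^ 2 : ℝ) : ℂ) * Complex.I := by
    have h0 : ((t : ℂ) ^ 2 + (y : ℂ) ^ 2) ≠ 0 := by
      exact_mod_cast (by positivity : t ^ 2 + y ^ 2 ≠ 0)
    refine inv_eq_of_mul_eq_one_right ?_
    push_cast
    field_simp
    linear_combination
      (-(3 * (t : ℂ) ^ 2 * y ^ 2 + y ^ 4 + 2 * t * y ^ 3 * Complex.I)) * Complex.I_sq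
  rw [h, Complex.add_im, Complex.ofReal_im, Complex.im_ofReal_mul, Complex.I_im, testKernel]
  ring

lemma lintegral_testKernel_le (t : ℝ) :
    ∫⁻ y in Ioc (0 : ℝ) 1, ‖testKernel t y‖ₑ ≤ ENNReal.ofReal (4 * Real.pi * (1 + t ^ 2)⁻¹) := by
  have habs : ∀ y : ℝ, |testKernel t y| = 2 * |t| * y ^ 2 / (t ^ 2 + y ^ 2) ^ 2 := fun y => by
    rw [testKernel, abs_div, abs_mul, abs_mul, abs_of_nonneg (by positivity : (0 : ℝ) ≤ y ^ 2),
      abs_of_nonneg (by positivity : (0 : ℝ) ≤ (t ^ 2 + y ^ 2) ^ 2), abs_two]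
  have hpi := Real.pi_gt_three
  rcases le_or_gt 1 |t| with ht | ht
  · calc ∫⁻ y in Ioc (0 : ℝ) 1, ‖testKernel t y‖ₑ
        ≤ ∫⁻ y in Ioc (0 : ℝ) 1, ENNReal.ofReal (4 * Real.pi * (1 + t ^ 2)⁻¹) := by
          refine setLIntegral_mono measurable_const fun y hy => ?_
          rw [Real.enorm_eq_ofReal_abs, habs]
          apply ENNReal.ofReal_le_ofReal
          have h1 : 1 ≤ t ^ 2 := by rw [← sq_abs]; nlinarith
          have hy2 : y ^ 2 ≤ 1 := by nlinarith [hy.1, hy.2]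
          rw [← div_eq_mul_inv, div_le_div_iff₀ (by positivity) (by positivity)]
          have h2 : |t| ≤ t ^ 2 := by rw [← sq_abs]; nlinarith
          have h3 : 2 * |t| * y ^ 2 * (1 + t ^ 2) ≤ 2 * t ^ 2 * 1 * (2 * t ^ 2) := by
            gcongr; linarith
          have h4 : (t ^ 2) ^ 2 ≤ (t ^ 2 + y ^ 2) ^ 2 := by gcongr; nlinarith [sq_nonneg y]
          nlinarith [sq_nonneg (t ^ 2 + y ^ 2)]
      _ = _ := by simp
  · rcases eq_or_ne t 0 with rfl | ht0
    · simp [testKernel]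
    · have htp : 0 < |t| := abs_pos.2 ht0
      calc ∫⁻ y in Ioc (0 : ℝ) 1, ‖testKernel t y‖ₑ
          ≤ ∫⁻ y : ℝ, ‖testKernel t y‖ₑ := setLIntegral_le_lintegral _ _
        _ ≤ ∫⁻ y : ℝ, ENNReal.ofReal 2 * ENNReal.ofReal (|t| / (y ^ 2 + |t| ^ 2)) := by
            refine lintegral_mono fun y => ?_
            rw [Real.enorm_eq_ofReal_abs, habs, ← ENNReal.ofReal_mul zero_le_two, sq_abs]
            apply ENNReal.ofReal_le_ofReal
            have h0 : 0 < t ^ 2 + y ^ 2 := by positivity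
            rw [add_comm (y ^ 2), ← mul_div_assoc, div_le_div_iff₀ (by positivity) h0]
            nlinarith [mul_nonneg (mul_nonneg htp.le h0.le) (sq_nonneg t)]
        _ = ENNReal.ofReal (2 * Real.pi) := by
            rw [lintegral_const_mul' _ _ ENNReal.ofReal_ne_top, lintegral_poisson htp,
              ENNReal.ofReal_mul zero_le_two]
        _ ≤ _ := by
            apply ENNReal.ofReal_le_ofReal
            have h1 : t ^ 2 ≤ 1 := by rw [← sq_abs]; nlinarith
            rw [← div_eq_mul_inv, le_div_iff₀ (by positivity)]
            nlinarith

lemma integral_div_add {r : ℝ} (hr : 0 ≤ r) :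
    ∫ y in Ioc (0 : ℝ) 1, r / (r + y) = r * (Real.log (r + 1) - Real.log r) := by
  rcases hr.eq_or_lt with rfl | hr
  · simp
  · rw [← intervalIntegral.integral_of_le zero_le_one,
      intervalIntegral.integral_eq_sub_of_hasDerivAt (f := fun y => r * Real.log (r + y))]
    · simp; ring
    · intro y hy
      rw [uIcc_of_le zero_le_one] at hy
      have h := ((((hasDerivAt_id y).const_add r).log (by simp; linarith [hy.1])).const_mul r)
      refine h.congr_deriv ?_
      simp [div_eq_mul_inv]
    · apply ContinuousOn.intervalIntegrable
      rw [uIcc_of_le zero_le_one]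
      exact ContinuousOn.div (by fun_prop) (by fun_prop) fun y hy => by linarith [hy.1]

lemma integrableOn_div_add {r : ℝ} (hr : 0 ≤ r) :
    IntegrableOn (fun y : ℝ => r / (r + y)) (Ioc 0 1) := by
  refine Integrable.mono' (g := fun _ => 1) (by simp)
    (by fun_prop : Measurable fun y : ℝ => r / (r + y)).aestronglyMeasurable ?_
  refine (ae_restrict_mem measurableSet_Ioc).mono fun y hy => ?_
  have := hy.1
  rw [Real.norm_of_nonneg (by positivity)]
  exact div_le_one_of_le₀ (by linarith) (by positivity)

/-- Testing the trace formula at `τ = -i y` and integrating over `0 < y ≤ 1`: a real spectral shift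
function forces `∑ aᵢ log (1 + 1/aᵢ) < ∞`, because
`∫₀¹ a / (a + y) dy = a log (1 + 1/a)` while the test kernels integrate to `O(1 / (1 + t²))`. -/
lemma summable_mul_abs_log_of_real_shift (ha : ∀ i, 0 ≤ a i) (hs : Summable a) {ω : ℝ → ℂ}
    (hω : Integrable fun t : ℝ => ω t / (1 + (t : ℂ) ^ 2))
    (hsum : ∀ τ : ℂ, τ.im < 0 →
      HasSum (fun i => resolventTerm τ (a i)) (-∫ t : ℝ, ω t / ((t : ℂ) - τ) ^ 2))
    (him : ∀ t, (ω t).im = 0) : Summable fun i => a i * |Real.log (a i)| := by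
  set r : ℝ → ℝ := fun t => (ω t).re with hr
  have hωr : ∀ t, ω t = (r t : ℂ) := fun t => Complex.ext rfl (him t)
  have hri : Integrable fun t : ℝ => r t * (1 + t ^ 2)⁻¹ := by
    refine hω.re.congr (.of_forall fun t => ?_)
    have : ω t / (1 + (t : ℂ) ^ 2) = ((r t * (1 + t ^ 2)⁻¹ : ℝ) : ℂ) := by
      rw [hωr]; push_cast; rfl
    simp only [this]
    exact Complex.ofReal_re _
  have hrm : AEMeasurable r := by
    have h := hri.aemeasurable.mul
      (by fun_prop : Measurable fun t : ℝ => 1 + t ^ 2).aemeasurable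
    refine h.congr (.of_forall fun t => ?_)
    have : (1 + t ^ 2) ≠ 0 := by positivity
    simp only [Pi.mul_apply]
    field_simp
  have hkm : Measurable fun p : ℝ × ℝ => testKernel p.1 p.2 := by
    unfold testKernel; fun_prop
  set M : ENNReal := ∫⁻ t : ℝ, ‖r t‖ₑ * ENNReal.ofReal (4 * Real.pi * (1 + t ^ 2)⁻¹) with hM
  have hMfin : M < ⊤ := by
    have h := (hri.const_mul (4 * Real.pi)).2
    refine lt_of_le_of_lt (le_of_eq (lintegral_congr fun t => ?_)) h
    rw [← Real.enorm_of_nonneg (by positivity), ← enorm_mul]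
    congr 1; ring
  have hpt : ∀ (F : Finset κ) (y : ℝ), 0 < y →
      ENNReal.ofReal (∑ i ∈ F, a i / (a i + y)) ≤ ∫⁻ t : ℝ, ‖r t‖ₑ * ‖testKernel t y‖ₑ := by
    intro F y hy
    have hτ : (-(Complex.I * y)).im < 0 := by simpa using hy
    have h1 := Complex.hasSum_im (hsum _ hτ)
    have hnn : ∀ i, 0 ≤ a i / (a i + y) := fun i => by have := ha i; positivity
    have h2 : HasSum (fun i => a i / (a i + y))
        (y * (-∫ t : ℝ, ω t / ((t : ℂ) - -(Complex.I * y)) ^ 2).im) := by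
      refine (h1.mul_left y).congr_fun fun i => ?_
      rw [resolventTerm_neg_I_mul hy (ha i), Complex.im_mul_ofReal, Complex.I_im, one_mul]
      have := ha i
      have : 0 < a i + y := by positivity
      field_simp
    have hint : Integrable fun t : ℝ => ω t / ((t : ℂ) - -(Complex.I * y)) ^ 2 :=
      integrable_div_ofReal_sub_sq measurable_id hω hτ.ne
    have h3 : y * (-∫ t : ℝ, ω t / ((t : ℂ) - -(Complex.I * y)) ^ 2).im =
        ∫ t, r t * testKernel t y := by
      have h4 := integral_im hint
      simp only [RCLike.im_eq_complex_im] at h4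
      rw [Complex.neg_im, ← h4, ← neg_mul_comm, ← integral_const_mul]
      refine integral_congr_ae (.of_forall fun t => ?_)
      simp only
      rw [hωr, div_eq_mul_inv, Complex.im_ofReal_mul]
      linear_combination (-(r t)) * im_inv_add_I_mul_sq (t := t) hy
    calc ENNReal.ofReal (∑ i ∈ F, a i / (a i + y))
        ≤ ENNReal.ofReal (∫ t, r t * testKernel t y) := by
          rw [← h3]
          exact ENNReal.ofReal_le_ofReal (sum_le_hasSum F (fun i _ => hnn i) h2)
      _ ≤ ‖∫ t, r t * testKernel t y‖ₑ := Real.ofReal_le_enorm _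
      _ ≤ ∫⁻ t, ‖r t * testKernel t y‖ₑ := enorm_integral_le_lintegral_enorm _
      _ = _ := by simp_rw [enorm_mul]
  have hbound : ∀ F : Finset κ, ∑ i ∈ F, a i * (Real.log (a i + 1) - Real.log (a i)) ≤
      M.toReal := by
    intro F
    rw [← ENNReal.ofReal_le_iff_le_toReal hMfin.ne]
    have hnn : ∀ᵐ y ∂(volume.restrict (Ioc (0 : ℝ) 1)), 0 ≤ ∑ i ∈ F, a i / (a i + y) :=
      (ae_restrict_mem measurableSet_Ioc).mono fun y hy =>
        Finset.sum_nonneg fun i _ => div_nonneg (ha i) (by linarith [ha i, hy.1])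
    calc ENNReal.ofReal (∑ i ∈ F, a i * (Real.log (a i + 1) - Real.log (a i)))
        = ENNReal.ofReal (∫ y in Ioc (0 : ℝ) 1, ∑ i ∈ F, a i / (a i + y)) := by
          rw [integral_finsetSum _ fun i _ => integrableOn_div_add (ha i)]
          simp_rw [integral_div_add (ha _)]
      _ = ∫⁻ y in Ioc (0 : ℝ) 1, ENNReal.ofReal (∑ i ∈ F, a i / (a i + y)) :=
          ofReal_integral_eq_lintegral_ofReal
            (integrable_finsetSum _ fun i _ => integrableOn_div_add (ha i)) hnn
      _ ≤ ∫⁻ y in Ioc (0 : ℝ) 1, ∫⁻ t : ℝ, ‖r t‖ₑ * ‖testKernel t y‖ₑ :=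
          lintegral_mono_ae ((ae_restrict_mem measurableSet_Ioc).mono fun y hy => hpt F y hy.1)
      _ = ∫⁻ t : ℝ, ∫⁻ y in Ioc (0 : ℝ) 1, ‖r t‖ₑ * ‖testKernel t y‖ₑ := by
          refine lintegral_lintegral_swap ?_
          exact (hrm.enorm.comp_snd).mul (hkm.comp measurable_swap).enorm.aemeasurable
      _ ≤ M := by
          refine lintegral_mono fun t => ?_
          rw [lintegral_const_mul' _ _ enorm_ne_top]
          gcongr
          exact lintegral_testKernel_le t
  have hsummable : Summable fun i => a i * (Real.log (a i + 1) - Real.log (a i)) := by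
    refine summable_of_sum_le (fun i => ?_) hbound
    rw [← integral_div_add (ha i)]
    exact setIntegral_nonneg measurableSet_Ioc fun y hy =>
      div_nonneg (ha i) (by linarith [ha i, hy.1])
  refine .of_nonneg_of_le (fun i => mul_nonneg (ha i) (abs_nonneg _)) (fun i => ?_)
    (hsummable.add (summable_sq_of_summable ha hs))
  rcases (ha i).eq_or_lt with h0 | h0
  · simp [← h0]
  · rw [sq, ← mul_add]
    refine mul_le_mul_of_nonneg_left ?_ (ha i)
    have h1 : Real.log (a i) ≤ Real.log (a i + 1) := Real.log_le_log h0 (by linarith)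
    have h2 : 0 ≤ Real.log (a i + 1) := Real.log_nonneg (by linarith)
    have h3 : Real.log (a i) ≤ a i := Real.log_le_self (ha i)
    rcases abs_cases (Real.log (a i)) with ⟨h, -⟩ | ⟨h, -⟩ <;> rw [h] <;> linarith

end Necessity

/-! ### Spectral shift functions of the pair `{iV, 0}` -/

theorem theorem7p6 {H : Type*} [NormedAddCommGroup H] [InnerProductSpace ℂ H] [CompleteSpace H]
    (V : H →L[ℂ] H) (hV : 0 ≤ V) (hV1 : IsTraceClass V) :
    (∃ ω ∈ spectralShiftFunctions (Complex.I • V) 0, ∀ t : ℝ, (ω t).re = 0) ∧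
    ∀ (ι : Type*) (α : ι → ℝ), IsEigenvalueFamily V α →
      ((∃ ω ∈ spectralShiftFunctions (Complex.I • V) 0, ∀ t : ℝ, (ω t).im = 0) ↔
        Summable fun n => α n * |Real.log (α n)|) := by
  obtain ⟨κ, b, a, hb, ha, hs⟩ := exists_hilbertBasis_diagonal hV hV1
  -- the kernel of `V` contributes nothing to the sums; without it the index set is countable
  have hcount : Countable {i // a i ≠ 0} := hs.countable_support
  have ha' : ∀ i : {i // a i ≠ 0}, 0 ≤ a i := fun i => ha i
  have hs' : Summable fun i : {i // a i ≠ 0} => a i := hs.subtype _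
  have hmem : ∀ ω, ω ∈ spectralShiftFunctions (Complex.I • V) 0 ↔
      Integrable (fun t : ℝ => ω t / (1 + (t : ℂ) ^ 2)) ∧
      ∀ τ : ℂ, τ.im < 0 → HasSum (fun i : {i // a i ≠ 0} => resolventTerm τ (a i))
        (-∫ t : ℝ, ω t / ((t : ℂ) - τ) ^ 2) := fun ω => by
    rw [mem_spectralShiftFunctions_iff hV hb ha hs]
    refine and_congr_right fun _ => forall₂_congr fun τ _ => Iff.symm ?_
    refine hasSum_subtype_iff_of_support_subset (f := fun i => resolventTerm τ (a i))
      (s := {i | a i ≠ 0}) fun i hi h0 => hi ?_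
    simp [resolventTerm, h0, inv_neg]
  refine ⟨?_, fun ι α hα => ?_⟩
  · obtain ⟨ω, hω, hre⟩ := exists_imaginary_shift ha' hs'
    exact ⟨ω, (hmem ω).2 hω, hre⟩
  · obtain ⟨hfam, hfin⟩ := isEigenvalueFamily_of_diagonal hV hb hs
    rw [summable_comp_iff_of_encard_eq (g := fun x => x * |Real.log x|) (by simp) hfin
        fun μ hμ => (hα μ hμ).trans (hfam μ hμ).symm,
      summable_comp_iff_restrict_ne_zero a (g := fun x => x * |Real.log x|) (by simp)]
    constructor
    · rintro ⟨ω, hω, him⟩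
      obtain ⟨h1, h2⟩ := (hmem ω).1 hω
      exact summable_mul_abs_log_of_real_shift ha' hs' h1 h2 him
    · intro hlog
      obtain ⟨ω, hω, him⟩ := exists_real_shift ha' hs' hlog
      exact ⟨ω, (hmem ω).2 hω, him⟩
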